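/- Let $\mathcal{M}$ be an oriented matroid on a finite ground set $E$ that is simple (it has no loops, parallel or antiparallel elements) and not acyclic, and let $\mathcal{T}$ be its set of topes (maximal covectors). For $e\in E$ put $\mathcal{T}_e^+:=\{T\in\mathcal{T}: T(e)=+\}$, and for $B\subseteq E$ put $\mathcal{T}_B^+:=\bigcap_{b\in B}\mathcal{T}_b^+$ (so $\mathcal{T}_\emptyset^+=\mathcal{T}$). A tope committee for $\mathcal{M}$ is a set $\mathcal{K}^*\subseteq\mathcal{T}$ such that $|\{K\in\mathcal{K}^*: K(e)=+\}|>|\{K\in\mathcal{K}^*: K(e)=-\}|$ for every $e\in E$; a tope anti-committee is a set $\mathcal{A}^*\subseteq\mathcal{T}$ such that $-\mathcal{A}^*$ is a tope committee. Let $\mathbf{K}_3^*(\mathcal{M})$ and $\mathbf{A}_3^*(\mathcal{M})$ be the families of tope committees and of tope anti-committees of cardinality $3$. A set $A\subseteq E$ is acyclic if the restriction of $\mathcal{M}$ to $A$ is acyclic. For an acyclic set $A$, $\mathrm{conv}(A)$ is the set of all $b\in E$ such that every covector $F$ with $F(a)=+$ for all $a\in A$ satisfies $F(b)=+$, and $\mathrm{ex}(A):=\{a\in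 A: a\notin\mathrm{conv}(A-\{a\})\}$; if $A$ is not acyclic, then $\mathrm{conv}(A):=E$; moreover $\mathrm{ex}(E):=E$. An acyclic set $A$ is convex if $\mathrm{conv}(A)=A$. Let $\widehat{L}$ be the poset of convex subsets of $E$ ordered by inclusion, with least element $\hat 0=\emptyset$, augmented by the greatest element $\hat 1:=E$. Then a set of three topes is an anti-committee if and only if it meets each positive halfspace $\mathcal{T}_e^+$ in at most one tope, and $$\#\mathbf{K}_3^*(\mathcal{M})=\#\mathbf{A}_3^*(\mathcal{M})=\sum_{\{S_1,S_2,S_3\}}\ \prod_{k=1}^{3}\Bigl|\,\bigcap_{s\in S_k}\mathcal{T}_s^+-\bigcup_{s\in E-S_k}\mathcal{T}_s^+\Bigr|$$ $$=\sum_{\{A_1,A_2,A_3\}}\ \prod_{k=1}^{3}\Bigl|\,\mathcal{T}_{\mathrm{ex}(A_k)}^+\cap\bigl(-\mathcal{T}_{\mathrm{ex}(\mathrm{conv}(E-A_k))}^+\bigr)\Bigr| .$$ The first sum is over all unordered triples of nonempty pairwise disjoint subsets of $E$. The second is over all unordered triples $\{A_1,A_2,A_3\}\subset\widehat{L}-\{\hat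 0,\hat 1\}$ with $A_1\wedge A_2=A_1\wedge A_3=A_2\wedge A_3=\hat 0$. -/

import Mathlib

open scoped Pointwise

/-- The composition `X ∘ Y` of two sign vectors. -/
def signComp {E : Type*} (X Y : E → SignType) : E → SignType :=
  fun e => if X e = 0 then Y e else X e

/-- `e` separates `X` and `Y`: the signs of `X` and `Y` at `e` are opposite and nonzero. -/
def Separates {E : Type*} (e : E) (X Y : E → SignType) : Prop :=
  X e ≠ 0 ∧ X e = -Y e

/-- The order of sign vectors induced componentwise by `0 < +`, `0 < -`. -/
def SignLE {E : Type*} (X Y : E → SignType) : Prop :=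
  ∀ e, X e ≠ 0 → X e = Y e

/-- An oriented matroid on the ground set `E`, given by its covectors. -/
structure OrientedMatroid (E : Type*) where
  covectors : Set (E → SignType)
  zero_mem : 0 ∈ covectors
  neg_mem : ∀ X ∈ covectors, -X ∈ covectors
  comp_mem : ∀ X ∈ covectors, ∀ Y ∈ covectors, signComp X Y ∈ covectors
  elim : ∀ X ∈ covectors, ∀ Y ∈ covectors, ∀ e, Separates e X Y →
    ∃ Z ∈ covectors, Z e = 0 ∧ ∀ f, ¬ Separates f X Y → Z f = signComp X Y f

namespace OrientedMatroid

/-- The restriction of `M` to `A`: its covectors are the restrictions of the covectors of `M`. -/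
def restrict {E : Type*} (M : OrientedMatroid E) (A : Finset E) : OrientedMatroid A where
  covectors := {X | ∃ F ∈ M.covectors, X = fun a : A => F a}
  zero_mem := ⟨0, M.zero_mem, rfl⟩
  neg_mem := by
    rintro _ ⟨F, hF, rfl⟩
    exact ⟨-F, M.neg_mem F hF, rfl⟩
  comp_mem := by
    rintro _ ⟨F, hF, rfl⟩ _ ⟨G, hG, rfl⟩
    exact ⟨signComp F G, M.comp_mem F hF G hG, rfl⟩
  elim := by
    rintro _ ⟨F, hF, rfl⟩ _ ⟨G, hG, rfl⟩ e he
    obtain ⟨Z, hZ, h0, h⟩ := M.elim F hF G hG e he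
    exact ⟨fun a => Z a, ⟨Z, hZ, rfl⟩, h0, fun f hf => h f hf⟩

/-- `M` is acyclic: the all-positive sign vector is a covector. -/
def IsAcyclic {E : Type*} (M : OrientedMatroid E) : Prop :=
  (fun _ => 1) ∈ M.covectors

/-- `M` has no loops, no parallel elements and no antiparallel elements. -/
def IsSimple {E : Type*} (M : OrientedMatroid E) : Prop :=
  (∀ e, ∃ F ∈ M.covectors, F e ≠ 0) ∧
  (∀ e f, e ≠ f → ∃ F ∈ M.covectors, F e ≠ F f) ∧
  (∀ e f, e ≠ f → ∃ F ∈ M.covectors, F e ≠ -F f)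

/-- A subset `A` of the ground set is acyclic if the restriction of `M` to `A` is acyclic. -/
def AcyclicSet {E : Type*} (M : OrientedMatroid E) (A : Finset E) : Prop :=
  (M.restrict A).IsAcyclic

theorem acyclicSet_mono {E : Type*} (M : OrientedMatroid E) {A B : Finset E}
    (h : A ⊆ B) (hB : M.AcyclicSet B) : M.AcyclicSet A := by
  obtain ⟨F, hF, h1⟩ := hB
  exact ⟨F, hF, funext fun a => congrFun h1 ⟨a.1, h a.2⟩⟩

section

variable {E : Type*} [Fintype E] [DecidableEq E]

open Classical in
/-- The set of topes, i.e. of maximal covectors. -/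
noncomputable def topes (M : OrientedMatroid E) : Finset (E → SignType) :=
  Finset.univ.filter fun T =>
    T ∈ M.covectors ∧ ∀ F ∈ M.covectors, SignLE T F → F = T

/-- The positive halfspace of `M` corresponding to `e`. -/
noncomputable def posHalfspace (M : OrientedMatroid E) (e : E) : Finset (E → SignType) :=
  M.topes.filter fun T => T e = 1

/-- The intersection (inside the set of topes) of the positive halfspaces corresponding to the
elements of `B`. -/
noncomputable def posInter (M : OrientedMatroid E) (B : Finset E) : Finset (E → SignType) :=
  M.topes.filter fun T => ∀ b ∈ B, T ∈ M.posHalfspace b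

/-- `K` is a tope committee for `M`. -/
def IsCommittee (M : OrientedMatroid E) (K : Finset (E → SignType)) : Prop :=
  K ⊆ M.topes ∧
    ∀ e, (K.filter fun T => T e = -1).card < (K.filter fun T => T e = 1).card

/-- `A` is a tope anti-committee for `M`: a set of topes such that `-A` is a tope committee. -/
def IsAntiCommittee (M : OrientedMatroid E) (A : Finset (E → SignType)) : Prop :=
  A ⊆ M.topes ∧ M.IsCommittee (-A)

open Classical in
/-- The family of tope committees of cardinality `k`. -/
noncomputable def committees (M : OrientedMatroid E) (k : ℕ) :
    Finset (Finset (E → SignType)) :=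
  Finset.univ.filter fun K => M.IsCommittee K ∧ K.card = k

open Classical in
/-- The family of tope anti-committees of cardinality `k`. -/
noncomputable def antiCommittees (M : OrientedMatroid E) (k : ℕ) :
    Finset (Finset (E → SignType)) :=
  Finset.univ.filter fun A => M.IsAntiCommittee A ∧ A.card = k

open Classical in
/-- The convex hull of `A`; by convention it is the whole ground set if `A` is not acyclic. -/
noncomputable def conv (M : OrientedMatroid E) (A : Finset E) : Finset E :=
  if M.AcyclicSet A then
    Finset.univ.filter fun b => ∀ F ∈ M.covectors, (∀ a ∈ A, F a = 1) → F b = 1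
  else Finset.univ

open Classical in
/-- The extreme points of `A`. The convention for sets that are not acyclic matters only for
the whole ground set `E`, where it says `ex E = E`. -/
noncomputable def ex (M : OrientedMatroid E) (A : Finset E) : Finset E :=
  if M.AcyclicSet A then A.filter fun a => a ∉ M.conv (A.erase a) else Finset.univ

/-- `A` is convex: it is acyclic and equal to its convex hull. -/
def IsConvex (M : OrientedMatroid E) (A : Finset E) : Prop :=
  M.AcyclicSet A ∧ M.conv A = A

theorem isConvex_empty (M : OrientedMatroid E) : M.IsConvex ∅ := by
  have h : M.AcyclicSet ∅ := ⟨0, M.zero_mem, funext fun a => absurd a.2 (Finset.notMem_empty _)⟩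
  refine ⟨h, ?_⟩
  rw [conv, if_pos h]
  ext b
  simp only [Finset.mem_filter, Finset.mem_univ, true_and, Finset.notMem_empty, iff_false]
  intro hb
  have := hb 0 M.zero_mem fun a ha => ha.elim
  simp at this

theorem isConvex_inter (M : OrientedMatroid E) {A B : Finset E} (hA : M.IsConvex A)
    (hB : M.IsConvex B) : M.IsConvex (A ∩ B) := by
  have h := M.acyclicSet_mono Finset.inter_subset_left hA.1 (A := A ∩ B)
  refine ⟨h, ?_⟩
  have hA' := hA.2
  have hB' := hB.2
  rw [conv, if_pos hA.1] at hA'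
  rw [conv, if_pos hB.1] at hB'
  rw [conv, if_pos h]
  ext b
  simp only [Finset.ext_iff, Finset.mem_filter, Finset.mem_univ, true_and] at hA' hB'
  simp only [Finset.mem_filter, Finset.mem_univ, true_and, Finset.mem_inter]
  constructor
  · intro hb
    exact ⟨(hA' b).1 fun F hF h1 => hb F hF fun a ha => h1 a ha.1,
      (hB' b).1 fun F hF h1 => hb F hF fun a ha => h1 a ha.2⟩
  · intro hb F _ h1
    exact h1 b hb

/-- The poset, ordered by inclusion, of the convex subsets of `E`, augmented by the greatest
element `E`. -/
abbrev LHat (M : OrientedMatroid E) : Type _ :=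
  {A : Finset E // M.IsConvex A ∨ A = Finset.univ}

/-- The least element is the empty set. -/
instance instOrderBotLHat (M : OrientedMatroid E) : OrderBot M.LHat :=
  Subtype.orderBot (Or.inl M.isConvex_empty)

/-- The greatest element is the ground set. -/
instance instOrderTopLHat (M : OrientedMatroid E) : OrderTop M.LHat :=
  Subtype.orderTop (Or.inr rfl)

/-- The meet is the intersection. -/
instance instSemilatticeInfLHat (M : OrientedMatroid E) : SemilatticeInf M.LHat :=
  Subtype.semilatticeInf (by
    rintro A B (hA | rfl) (hB | rfl)
    · exact Or.inl (M.isConvex_inter hA hB)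
    · exact Or.inl (by simpa using hA)
    · exact Or.inl (by simpa using hB)
    · exact Or.inr (by simp))

noncomputable instance instFintypeLHat (M : OrientedMatroid E) : Fintype M.LHat :=
  Fintype.ofFinite _

open Classical in
/-- The three-element families of nonempty pairwise disjoint subsets of `E`. -/
noncomputable def disjointTriples (E : Type*) [Fintype E] : Finset (Finset (Finset E)) :=
  Finset.univ.filter fun S =>
    S.card = 3 ∧ (∀ A ∈ S, A.Nonempty) ∧ ∀ A ∈ S, ∀ B ∈ S, A ≠ B → Disjoint A B

open Classical in
/-- The three-element subsets of `LHat - {⊥, ⊤}` whose elements have pairwise meet `⊥`. -/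
noncomputable def meetDisjointTriples (M : OrientedMatroid E) : Finset (Finset M.LHat) :=
  Finset.univ.filter fun S =>
    S.card = 3 ∧ (∀ A ∈ S, A ≠ ⊥ ∧ A ≠ ⊤) ∧ ∀ A ∈ S, ∀ B ∈ S, A ≠ B → A ⊓ B = ⊥

end

end OrientedMatroid

/-!
Since `M` has no loops, its topes are the covectors without zero entries, so a tope `T` is
determined by its positive part `posPart T`. Among three topes, the strict majority at `e` is
negative exactly when at most one of them is positive at `e`; hence the anti-committees of
cardinality `3` are the triples of topes with pairwise disjoint positive parts
(`isAntiCommittee_iff_disjoint`). As `M` is not acyclic, no positive part is empty or the whole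
ground set.

Both sums then follow from one counting principle (`card_eq_sum_prod_card_fiber`): the map sending
a triple of topes to the triple of its positive parts is injective, and each product in the sum is
`1` or `0` according to whether all members of the triple are positive parts of topes. For the
first sum, the `k`-th factor counts the topes with positive part `S_k` by definition.

For the second sum, the positive part of a tope is convex, and a tope has positive part `A` iff it
is positive on `A` and negative on the complement of `A`. That these conditions need only be tested
on `ex A` and on `ex (conv Aᶜ)` is the theorem that an acyclic set lies in the convex hull of its
extreme points (`eq_one_of_pos_on_ex`). It follows from the anti-exchange property of the hull
(`PosHull.anti_exchange`), which is where the absence of parallel elements enters.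
-/

/-! ### Counting families of sets through an injective map -/

/-- Let `P` be injective on `𝒯`, and let the members of `𝒜` be the subsets of `𝒯` whose image under
`P` lies in `𝒮`. Then `𝒜` is counted by the sum over `𝒮` of the products of the fibre sizes, because
every fibre has at most one element. -/
theorem card_eq_sum_prod_card_fiber {α ι : Type*} [DecidableEq α] [DecidableEq ι]
    {𝒯 : Finset α} {P : α → ι} (hP : Set.InjOn P 𝒯) {𝒜 : Finset (Finset α)}
    {𝒮 : Finset (Finset ι)} (h𝒜 : ∀ A ∈ 𝒜, A ⊆ 𝒯)
    (hmem : ∀ A ⊆ 𝒯, (A ∈ 𝒜 ↔ A.image P ∈ 𝒮)) {f : ι → ℕ}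
    (hf : ∀ S ∈ 𝒮, ∀ s ∈ S, f s = (𝒯.filter fun T => P T = s).card) :
    𝒜.card = ∑ S ∈ 𝒮, ∏ s ∈ S, f s := by
  have hfib : ∀ s, (𝒯.filter fun T => P T = s).card = if s ∈ 𝒯.image P then 1 else 0 := by
    intro s
    split_ifs with hs
    · obtain ⟨T, hT, rfl⟩ := Finset.mem_image.1 hs
      rw [Finset.card_eq_one]
      refine ⟨T, Finset.ext fun U => ?_⟩
      simp only [Finset.mem_filter, Finset.mem_singleton]
      exact ⟨fun h => hP h.1 hT h.2, by rintro rfl; exact ⟨hT, rfl⟩⟩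
    · rw [Finset.card_eq_zero, Finset.filter_eq_empty_iff]
      exact fun T hT h => hs (Finset.mem_image.2 ⟨T, hT, h⟩)
  have hprod : ∀ S ∈ 𝒮, ∏ s ∈ S, f s = if S ⊆ 𝒯.image P then 1 else 0 := by
    intro S hS
    rw [Finset.prod_congr rfl fun s hs => (hf S hS s hs).trans (hfib s)]
    split_ifs with h
    · exact Finset.prod_eq_one fun s hs => if_pos (h hs)
    · obtain ⟨s, hs, hs'⟩ := Finset.not_subset.1 h
      exact Finset.prod_eq_zero hs (if_neg hs')
  rw [Finset.sum_congr rfl hprod, ← Finset.card_filter]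
  refine Finset.card_bij (fun A _ => A.image P) ?_ ?_ ?_
  · intro A hA
    exact Finset.mem_filter.2
      ⟨(hmem A (h𝒜 A hA)).1 hA, Finset.image_subset_image (h𝒜 A hA)⟩
  · intro A hA B hB h
    refine Finset.coe_injective ((hP.image_eq_image_iff (h𝒜 A hA) (h𝒜 B hB)).1 ?_)
    simpa only [Finset.coe_image] using congrArg (fun S : Finset ι => (S : Set ι)) h
  · intro S hS
    obtain ⟨hS, hsub⟩ := Finset.mem_filter.1 hS
    obtain ⟨A, hA, rfl⟩ := Finset.subset_image_iff.1 hsub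
    exact ⟨A, (hmem A hA).2 hS, rfl⟩

namespace OrientedMatroid

/-! ### Convex hulls and extreme points -/

section Hull

variable {E : Type*} {M : OrientedMatroid E}

/-- `b` lies in the positive hull of `B`: every covector that is positive on `B` is positive
at `b`. For acyclic `B` these are the elements of `M.conv B`. -/
def PosHull (M : OrientedMatroid E) (B : Finset E) (b : E) : Prop :=
  ∀ F ∈ M.covectors, (∀ a ∈ B, F a = 1) → F b = 1

theorem signComp_of_ne_zero {X Y : E → SignType} {e : E} (h : X e ≠ 0) :
    signComp X Y e = X e := if_neg h

theorem signComp_of_eq_zero {X Y : E → SignType} {e : E} (h : X e = 0) :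
    signComp X Y e = Y e := if_pos h

theorem signComp_of_eq_one {X Y : E → SignType} {e : E} (h : X e = 1) :
    signComp X Y e = 1 := by
  rw [signComp_of_ne_zero (by rw [h]; decide), h]

theorem acyclicSet_iff {A : Finset E} :
    M.AcyclicSet A ↔ ∃ F ∈ M.covectors, ∀ a ∈ A, F a = 1 := by
  constructor
  · rintro ⟨F, hF, h⟩
    exact ⟨F, hF, fun a ha => (congrFun h ⟨a, ha⟩).symm⟩
  · rintro ⟨F, hF, h⟩
    exact ⟨F, hF, funext fun a => (h a a.2).symm⟩

theorem acyclicSet_univ_iff [Fintype E] : M.AcyclicSet Finset.univ ↔ M.IsAcyclic := by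
  rw [acyclicSet_iff]
  constructor
  · rintro ⟨F, hF, h⟩
    rwa [funext fun e => h e (Finset.mem_univ e)] at hF
  · exact fun h => ⟨_, h, fun _ _ => rfl⟩

/-- In a simple oriented matroid, two distinct elements are told apart by a covector that is
positive at exactly one of them. -/
theorem IsSimple.exists_pos_of_ne (hM : M.IsSimple) {x y : E} (hxy : x ≠ y) :
    ∃ G ∈ M.covectors, (G x = 1 ∧ G y ≠ 1) ∨ (G y = 1 ∧ G x ≠ 1) := by
  obtain ⟨G, hG, hne⟩ := hM.2.1 x y hxy
  by_cases h : (G x = 1 ∧ G y ≠ 1) ∨ (G y = 1 ∧ G x ≠ 1)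
  · exact ⟨G, hG, h⟩
  · refine ⟨-G, M.neg_mem G hG, ?_⟩
    simp only [Pi.neg_apply]
    revert hne h
    generalize G x = s
    generalize G y = t
    revert s t
    decide

variable [DecidableEq E]

/-- If `x` and `y` were each in the hull of `B` together with the other one, but `x` not in that of
`B` alone, elimination would produce a covector positive on `B` and zero at both `x` and `y`; composing it with a covector
positive at only one of the two contradicts the assumption. -/
theorem PosHull.anti_exchange (hM : M.IsSimple) {B : Finset E} {x y : E} (hxy : x ≠ y)
    (hac : M.AcyclicSet (insert x (insert y B))) (hx : ¬ M.PosHull B x)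
    (hy : M.PosHull (insert x B) y) : ¬ M.PosHull (insert y B) x := by
  intro hx'
  obtain ⟨T, hT, hT1⟩ := acyclicSet_iff.1 hac
  have hTx : T x = 1 := hT1 x (by simp)
  have hTB : ∀ a ∈ B, T a = 1 := fun a ha => hT1 a (by simp [ha])
  -- By assumption, `x` and `y` are indistinguishable by positivity to covectors positive on `B`.
  have key : ∀ F ∈ M.covectors, (∀ a ∈ B, F a = 1) → (F x = 1 ↔ F y = 1) := fun F hF hB =>
    ⟨fun h => hy F hF (by simpa [h] using hB), fun h => hx' F hF (by simpa [h] using hB)⟩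
  obtain ⟨Z, hZ, hZB, hZx⟩ : ∃ Z ∈ M.covectors, (∀ a ∈ B, Z a = 1) ∧ Z x = 0 := by
    simp only [PosHull, not_forall] at hx
    obtain ⟨F, hF, hFB, hFx⟩ := hx
    -- A covector negative at `x` is made zero there by elimination against the positive `T`.
    rcases SignType.trichotomy (F x) with h | h | h
    · obtain ⟨Z, hZ, hZx, hZf⟩ := M.elim F hF T hT x ⟨by rw [h]; decide, by rw [h, hTx]⟩
      refine ⟨Z, hZ, fun a ha => ?_, hZx⟩
      rw [hZf a, signComp_of_eq_one (hFB a ha)]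
      rintro ⟨-, h'⟩
      rw [hFB a ha, hTB a ha] at h'
      exact absurd h' (by decide)
    · exact ⟨F, hF, hFB, h⟩
    · exact absurd h hFx
  have comp : ∀ G ∈ M.covectors, (signComp Z G x = 1 ↔ signComp Z G y = 1) := fun G hG =>
    key _ (M.comp_mem Z hZ G hG) fun a ha => signComp_of_eq_one (hZB a ha)
  -- `signComp Z T` is positive at `x`; a nonzero `Z y` would survive there and so be positive.
  have hZy : Z y = 0 := by
    by_contra h
    have h1 := (comp T hT).1 ((signComp_of_eq_zero hZx).trans hTx)
    rw [signComp_of_ne_zero h] at h1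
    have h2 := (key Z hZ hZB).2 h1
    rw [hZx] at h2
    exact absurd h2 (by decide)
  obtain ⟨G, hG, h⟩ := hM.exists_pos_of_ne hxy
  have h' := comp G hG
  rw [signComp_of_eq_zero hZx, signComp_of_eq_zero hZy] at h'
  tauto

/-- An acyclic set `A` lies in the hull of a set of extreme points: an inclusion-minimal
`B ⊆ A` whose hull contains `A` consists of extreme points, by anti-exchange. -/
theorem exists_posHull_extreme (hM : M.IsSimple) {A : Finset E} (hA : M.AcyclicSet A) :
    ∃ B ⊆ A, (∀ b ∈ B, ¬ M.PosHull (A.erase b) b) ∧ ∀ a ∈ A, M.PosHull B a := by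
  classical
  obtain ⟨B, hB⟩ := (A.powerset.filter fun B => ∀ a ∈ A, M.PosHull B a).exists_minimal
    ⟨A, Finset.mem_filter.2 ⟨Finset.mem_powerset_self A, fun a ha F _ h => h a ha⟩⟩
  obtain ⟨hBA, hgen⟩ := Finset.mem_filter.1 hB.prop
  rw [Finset.mem_powerset] at hBA
  refine ⟨B, hBA, fun b hb hbA => ?_, hgen⟩
  -- By minimality no element of `B` is in the hull of the others.
  have hbB : ¬ M.PosHull (B.erase b) b := by
    intro h
    have hmem : B.erase b ∈ A.powerset.filter fun B => ∀ a ∈ A, M.PosHull B a := by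
      refine Finset.mem_filter.2
        ⟨Finset.mem_powerset.2 ((Finset.erase_subset _ _).trans hBA), fun a ha F hF hF1 => ?_⟩
      refine hgen a ha F hF fun c hc => ?_
      by_cases hcb : c = b
      · exact hcb ▸ h F hF hF1
      · exact hF1 c (Finset.mem_erase.2 ⟨hcb, hc⟩)
    exact Finset.notMem_erase b B (hB.le_of_le hmem (Finset.erase_subset b B) hb)
  -- Enlarge `B.erase b` inside `A` as long as `b` stays outside the hull.
  obtain ⟨C, hC⟩ := (A.powerset.filter fun C => B.erase b ⊆ C ∧ ¬ M.PosHull C b).exists_maximal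
    ⟨B.erase b, Finset.mem_filter.2 ⟨Finset.mem_powerset.2
      ((Finset.erase_subset _ _).trans hBA), subset_rfl, hbB⟩⟩
  obtain ⟨hCA, hBC, hbC⟩ := Finset.mem_filter.1 hC.prop
  rw [Finset.mem_powerset] at hCA
  have hnot : ¬ A.erase b ⊆ C := fun h => hbC fun F hF h1 => hbA F hF fun a ha => h1 a (h ha)
  obtain ⟨y, hyA, hyC⟩ := Finset.not_subset.1 hnot
  obtain ⟨hyb, hyA⟩ := Finset.mem_erase.1 hyA
  have hby : M.PosHull (insert y C) b := by
    by_contra h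
    exact hyC (hC.le_of_ge (Finset.mem_filter.2 ⟨Finset.mem_powerset.2
      (Finset.insert_subset hyA hCA), hBC.trans (Finset.subset_insert _ _), h⟩)
      (Finset.subset_insert _ _) (Finset.mem_insert_self _ _))
  have hyb' : M.PosHull (insert b C) y := fun F hF h1 => hgen y hyA F hF fun c hc => h1 c <| by
    by_cases hcb : c = b
    · simp [hcb]
    · exact Finset.mem_insert_of_mem (hBC (Finset.mem_erase.2 ⟨hcb, hc⟩))
  exact PosHull.anti_exchange hM hyb.symm
    (M.acyclicSet_mono (Finset.insert_subset (hBA hb) (Finset.insert_subset hyA hCA)) hA)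
    hbC hyb' hby

variable [Fintype E]

theorem mem_conv {A : Finset E} (hA : M.AcyclicSet A) {b : E} :
    b ∈ M.conv A ↔ M.PosHull A b := by
  simp [conv, hA, PosHull]

/-- The Krein–Milman property: an acyclic set lies in the hull of its extreme points. -/
theorem eq_one_of_pos_on_ex (hM : M.IsSimple) {A : Finset E} (hA : M.AcyclicSet A)
    {F : E → SignType} (hF : F ∈ M.covectors) (h : ∀ a ∈ M.ex A, F a = 1) :
    ∀ a ∈ A, F a = 1 := by
  obtain ⟨B, hBA, hB, hgen⟩ := exists_posHull_extreme hM hA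
  refine fun a ha => hgen a ha F hF fun b hb => h b ?_
  rw [ex, if_pos hA]
  exact Finset.mem_filter.2 ⟨hBA hb, fun hc =>
    hB b hb ((mem_conv (M.acyclicSet_mono (Finset.erase_subset _ _) hA)).1 hc)⟩

theorem forall_ex_eq_one_iff (hM : M.IsSimple) {A : Finset E} (hA : M.AcyclicSet A)
    {F : E → SignType} (hF : F ∈ M.covectors) :
    (∀ a ∈ M.ex A, F a = 1) ↔ ∀ a ∈ A, F a = 1 := by
  refine ⟨eq_one_of_pos_on_ex hM hA hF, fun h a ha => h a ?_⟩
  rw [ex, if_pos hA] at ha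
  exact (Finset.mem_filter.1 ha).1

/-- Testing positivity on the extreme points of the hull of an arbitrary set `A` amounts to testing
it on `A`. If `A` is not acyclic, both sides fail, as they would make `A` or the ground set
acyclic. -/
theorem forall_ex_conv_eq_one_iff (hM : M.IsSimple) (hcyc : ¬ M.IsAcyclic) {A : Finset E}
    {F : E → SignType} (hF : F ∈ M.covectors) :
    (∀ a ∈ M.ex (M.conv A), F a = 1) ↔ ∀ a ∈ A, F a = 1 := by
  by_cases hA : M.AcyclicSet A
  · have hconv : M.AcyclicSet (M.conv A) := by
      obtain ⟨G, hG, hG1⟩ := acyclicSet_iff.1 hA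
      exact acyclicSet_iff.2 ⟨G, hG, fun a ha => (mem_conv hA).1 ha G hG hG1⟩
    rw [forall_ex_eq_one_iff hM hconv hF]
    exact ⟨fun h a ha => h a ((mem_conv hA).2 fun G _ h1 => h1 a ha),
      fun h a ha => (mem_conv hA).1 ha F hF h⟩
  · refine ⟨fun h => absurd ?_ hcyc, fun h => absurd (acyclicSet_iff.2 ⟨F, hF, h⟩) hA⟩
    have huniv : ¬ M.AcyclicSet Finset.univ := fun h' => hcyc (acyclicSet_univ_iff.1 h')
    rw [conv, if_neg hA, ex, if_neg huniv] at h
    exact acyclicSet_univ_iff.1 (acyclicSet_iff.2 ⟨F, hF, h⟩)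

end Hull

/-! ### Topes and their positive parts -/

section Topes

variable {E : Type*} [Fintype E]

/-- The set of elements at which a sign vector is positive. -/
def posPart (T : E → SignType) : Finset E := Finset.univ.filter fun e => T e = 1

@[simp]
theorem mem_posPart {T : E → SignType} {e : E} : e ∈ posPart T ↔ T e = 1 := by
  simp [posPart]

variable [DecidableEq E] {M : OrientedMatroid E}

/-- Without loops the topes are the covectors without zeros: a covector that vanishes at `e` lies
strictly below its composition with one that does not. -/
theorem mem_topes_iff (hM : M.IsSimple) {T : E → SignType} :
    T ∈ M.topes ↔ T ∈ M.covectors ∧ ∀ e, T e ≠ 0 := by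
  simp only [topes, Finset.mem_filter, Finset.mem_univ, true_and]
  refine and_congr_right fun hT => ⟨fun h e he => ?_, fun h F _ hle => ?_⟩
  · obtain ⟨F, hF, hFe⟩ := hM.1 e
    have := h _ (M.comp_mem T hT F hF) fun f hf => (signComp_of_ne_zero hf).symm
    have h2 := congrFun this e
    rw [signComp_of_eq_zero he, he] at h2
    exact hFe h2
  · exact funext fun e => (hle e (h e)).symm

theorem neg_mem_topes (hM : M.IsSimple) {T : E → SignType} (hT : T ∈ M.topes) :
    -T ∈ M.topes := by
  rw [mem_topes_iff hM] at hT ⊢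
  refine ⟨M.neg_mem T hT.1, fun e h => hT.2 e ?_⟩
  rw [Pi.neg_apply] at h
  generalize T e = s at h ⊢
  revert s
  decide

theorem mem_posInter {B : Finset E} {T : E → SignType} :
    T ∈ M.posInter B ↔ T ∈ M.topes ∧ ∀ b ∈ B, T b = 1 := by
  simp only [posInter, posHalfspace, Finset.mem_filter]
  exact and_congr_right fun hT => by simp [hT]

theorem eq_neg_one_of_mem_topes (hM : M.IsSimple) {T : E → SignType} (hT : T ∈ M.topes) {e : E}
    (h : T e ≠ 1) : T e = -1 := by
  have h0 := ((mem_topes_iff hM).1 hT).2 e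
  generalize T e = s at h h0 ⊢
  revert s
  decide

theorem posPart_injOn (hM : M.IsSimple) :
    Set.InjOn posPart (M.topes : Set (E → SignType)) := by
  intro T hT U hU h
  funext e
  have he : T e = 1 ↔ U e = 1 := by rw [← mem_posPart, h, mem_posPart]
  by_cases h1 : T e = 1
  · rw [h1, he.1 h1]
  · rw [eq_neg_one_of_mem_topes hM hT h1,
      eq_neg_one_of_mem_topes hM hU fun h2 => h1 (he.2 h2)]

theorem posPart_nonempty (hM : M.IsSimple) (hcyc : ¬ M.IsAcyclic) {T : E → SignType}
    (hT : T ∈ M.topes) : (posPart T).Nonempty := by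
  by_contra h
  rw [Finset.not_nonempty_iff_eq_empty] at h
  refine hcyc (acyclicSet_univ_iff.1 (acyclicSet_iff.2
    ⟨-T, ((mem_topes_iff hM).1 (neg_mem_topes hM hT)).1, fun e _ => ?_⟩))
  rw [Pi.neg_apply, eq_neg_one_of_mem_topes hM hT, neg_neg]
  rw [ne_eq, ← mem_posPart, h]
  exact Finset.notMem_empty e

theorem posPart_ne_univ (hM : M.IsSimple) (hcyc : ¬ M.IsAcyclic) {T : E → SignType}
    (hT : T ∈ M.topes) : posPart T ≠ Finset.univ := fun h =>
  hcyc (acyclicSet_univ_iff.1 (acyclicSet_iff.2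
    ⟨T, ((mem_topes_iff hM).1 hT).1, fun _ he => mem_posPart.1 (h ▸ he)⟩))

theorem isConvex_posPart (hM : M.IsSimple) {T : E → SignType} (hT : T ∈ M.topes) :
    M.IsConvex (posPart T) := by
  have hcov := ((mem_topes_iff hM).1 hT).1
  have hac : M.AcyclicSet (posPart T) := acyclicSet_iff.2 ⟨T, hcov, fun a => mem_posPart.1⟩
  refine ⟨hac, Finset.ext fun b => ?_⟩
  rw [mem_conv hac]
  exact ⟨fun h => mem_posPart.2 (h T hcov fun a => mem_posPart.1),
    fun hb F _ h1 => h1 b hb⟩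

theorem posInter_sdiff_eq (A : Finset E) :
    M.posInter A \ Aᶜ.biUnion M.posHalfspace = M.topes.filter fun T => posPart T = A := by
  ext T
  simp only [Finset.mem_sdiff, mem_posInter, Finset.mem_biUnion, Finset.mem_compl, posHalfspace,
    Finset.mem_filter, Finset.ext_iff, mem_posPart, not_exists, not_and]
  constructor
  · rintro ⟨⟨hT, h⟩, h'⟩
    exact ⟨hT, fun e => ⟨fun h1 => by_contra fun he => h' e he hT h1, h e⟩⟩
  · rintro ⟨hT, h⟩
    exact ⟨⟨hT, fun e => (h e).2⟩, fun e he _ h1 => he ((h e).1 h1)⟩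

/-- The factors of the second sum are those of the first: a tope is positive on `A` and negative on
`Aᶜ` as soon as it is so on the extreme points of `A` and of the hull of `Aᶜ`. -/
theorem posInter_ex_inter_eq (hM : M.IsSimple) (hcyc : ¬ M.IsAcyclic) {A : Finset E}
    (hA : M.AcyclicSet A) :
    M.posInter (M.ex A) ∩ -M.posInter (M.ex (M.conv Aᶜ)) =
      M.topes.filter fun T => posPart T = A := by
  ext T
  rw [Finset.mem_inter, Finset.mem_neg', mem_posInter, mem_posInter, Finset.mem_filter,
    and_assoc]
  refine and_congr_right fun hT => ?_
  have hT' := neg_mem_topes hM hT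
  rw [forall_ex_eq_one_iff hM hA ((mem_topes_iff hM).1 hT).1,
    forall_ex_conv_eq_one_iff hM hcyc ((mem_topes_iff hM).1 hT').1]
  simp only [hT', true_and, Pi.neg_apply, Finset.mem_compl, Finset.ext_iff, mem_posPart]
  constructor
  · rintro ⟨h1, h2⟩ e
    refine ⟨fun h => by_contra fun he => ?_, h1 e⟩
    have := h2 e he
    rw [h] at this
    exact absurd this (by decide)
  · intro h
    refine ⟨fun e => (h e).2, fun e he => ?_⟩
    rw [eq_neg_one_of_mem_topes hM hT fun h1 => he ((h e).1 h1), neg_neg]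

/-! ### Anti-committees of cardinality three -/

/-- The three signs of the members of `A` at `e` are nonzero, so the negative ones are in the
majority iff at most one is positive. -/
theorem isAntiCommittee_iff_card_le_one (hM : M.IsSimple) {A : Finset (E → SignType)}
    (hA : A ⊆ M.topes) (hcard : A.card = 3) :
    M.IsAntiCommittee A ↔ ∀ e, (M.posHalfspace e ∩ A).card ≤ 1 := by
  have hneg : -A ⊆ M.topes := fun T hT => by
    simpa using neg_mem_topes hM (hA (Finset.mem_neg'.1 hT))
  simp only [IsAntiCommittee, IsCommittee, hA, hneg, true_and]
  refine forall_congr' fun e => ?_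
  have hflip : ∀ s : SignType, ((-A).filter fun T => T e = s).card =
      (A.filter fun T => T e = -s).card := by
    intro s
    refine Finset.card_bij (fun T _ => -T) ?_ (fun T _ U _ h => neg_injective h) ?_
    · intro T hT
      obtain ⟨hT, hs⟩ := Finset.mem_filter.1 hT
      exact Finset.mem_filter.2 ⟨Finset.mem_neg'.1 hT, congrArg Neg.neg hs⟩
    · intro T hT
      obtain ⟨hT, hs⟩ := Finset.mem_filter.1 hT
      exact ⟨-T, Finset.mem_filter.2 ⟨Finset.neg_mem_neg hT, by simp [hs]⟩, neg_neg T⟩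
  have hpos : M.posHalfspace e ∩ A = A.filter fun T => T e = 1 := by
    ext T
    simp only [posHalfspace, Finset.mem_inter, Finset.mem_filter]
    exact ⟨fun h => ⟨h.2, h.1.2⟩, fun h => ⟨⟨hA h.1, h.2⟩, h.1⟩⟩
  have hrest : (A.filter fun T => ¬ T e = 1) = A.filter fun T => T e = -1 :=
    Finset.filter_congr fun T hT => ⟨fun h => eq_neg_one_of_mem_topes hM (hA hT) h,
      fun h h1 => absurd (h.symm.trans h1) (by decide)⟩
  have hsum := Finset.card_filter_add_card_filter_not (s := A) (fun T => T e = 1)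
  rw [hrest, hcard] at hsum
  rw [hflip, hflip, hpos, neg_neg]
  omega

theorem isAntiCommittee_iff_disjoint (hM : M.IsSimple) {A : Finset (E → SignType)}
    (hA : A ⊆ M.topes) (hcard : A.card = 3) :
    M.IsAntiCommittee A ↔ ∀ T ∈ A, ∀ U ∈ A, T ≠ U → Disjoint (posPart T) (posPart U) := by
  rw [isAntiCommittee_iff_card_le_one hM hA hcard]
  simp only [Finset.card_le_one, posHalfspace, Finset.mem_inter, Finset.mem_filter,
    Finset.disjoint_left, mem_posPart]
  constructor
  · intro h T hT U hU hne e h1 h2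
    exact hne (h e T ⟨⟨hA hT, h1⟩, hT⟩ U ⟨⟨hA hU, h2⟩, hU⟩)
  · rintro h e T ⟨⟨-, h1⟩, hT⟩ U ⟨⟨-, h2⟩, hU⟩
    exact by_contra fun hne => h T hT U hU hne h1 h2

theorem mem_committees {k : ℕ} {K : Finset (E → SignType)} :
    K ∈ M.committees k ↔ M.IsCommittee K ∧ K.card = k := by
  simp [committees]

theorem mem_antiCommittees {k : ℕ} {A : Finset (E → SignType)} :
    A ∈ M.antiCommittees k ↔ M.IsAntiCommittee A ∧ A.card = k := by
  simp [antiCommittees]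

theorem mem_disjointTriples {S : Finset (Finset E)} :
    S ∈ disjointTriples E ↔ S.card = 3 ∧ (∀ A ∈ S, A.Nonempty) ∧
      ∀ A ∈ S, ∀ B ∈ S, A ≠ B → Disjoint A B := by
  simp [disjointTriples]

theorem mem_meetDisjointTriples {S : Finset M.LHat} :
    S ∈ M.meetDisjointTriples ↔ S.card = 3 ∧ (∀ A ∈ S, A ≠ ⊥ ∧ A ≠ ⊤) ∧
      ∀ A ∈ S, ∀ B ∈ S, A ≠ B → A ⊓ B = ⊥ := by
  classical
  simp [meetDisjointTriples]

theorem card_committees_eq (hM : M.IsSimple) (k : ℕ) :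
    (M.committees k).card = (M.antiCommittees k).card := by
  refine Finset.card_bij (fun K _ => -K) ?_ (fun K _ L _ h => neg_injective h) ?_
  · intro K hK
    rw [mem_committees] at hK
    rw [mem_antiCommittees, IsAntiCommittee, neg_neg, Finset.card_neg]
    refine ⟨⟨fun T hT => ?_, hK.1⟩, hK.2⟩
    simpa using neg_mem_topes hM (hK.1.1 (Finset.mem_neg'.1 hT))
  · intro A hA
    rw [mem_antiCommittees, IsAntiCommittee] at hA
    exact ⟨-A, mem_committees.2 ⟨hA.1.2, by rw [Finset.card_neg, hA.2]⟩, neg_neg A⟩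

theorem card_antiCommittees_eq_sum_disjointTriples (hM : M.IsSimple) (hcyc : ¬ M.IsAcyclic) :
    (M.antiCommittees 3).card = ∑ S ∈ disjointTriples E, ∏ A ∈ S,
      (M.posInter A \ Aᶜ.biUnion M.posHalfspace).card := by
  refine card_eq_sum_prod_card_fiber (posPart_injOn hM) (fun A hA => ?_) (fun A hA => ?_)
    fun S _ A _ => congrArg Finset.card (posInter_sdiff_eq A)
  · exact (mem_antiCommittees.1 hA).1.1
  · have hinj : Set.InjOn posPart (A : Set (E → SignType)) := (posPart_injOn hM).mono hA
    simp only [mem_antiCommittees, mem_disjointTriples,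
      Finset.card_image_of_injOn hinj, Finset.forall_mem_image]
    rw [and_comm]
    refine and_congr_right fun hcard => ?_
    rw [isAntiCommittee_iff_disjoint hM hA hcard]
    constructor
    · exact fun h => ⟨fun T hT => posPart_nonempty hM hcyc (hA hT),
        fun T hT U hU hne => h T hT U hU fun he => hne (he ▸ rfl)⟩
    · exact fun h T hT U hU hne => h.2 hT hU fun he => hne (hinj hT hU he)

/-- The positive part of a tope as an element of `M.LHat`. A sign vector whose positive part is not
convex, hence not a tope, is sent to `⊥`. -/
noncomputable def posPartLHat (M : OrientedMatroid E) (T : E → SignType) : M.LHat :=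
  open Classical in if h : M.IsConvex (posPart T) then ⟨posPart T, Or.inl h⟩ else ⊥

theorem coe_posPartLHat (hM : M.IsSimple) {T : E → SignType} (hT : T ∈ M.topes) :
    (M.posPartLHat T).1 = posPart T := by
  rw [posPartLHat, dif_pos (isConvex_posPart hM hT)]

theorem posPartLHat_injOn (hM : M.IsSimple) :
    Set.InjOn M.posPartLHat (M.topes : Set (E → SignType)) := by
  intro T hT U hU h
  refine posPart_injOn hM hT hU ?_
  rw [← coe_posPartLHat hM hT, ← coe_posPartLHat hM hU, h]

theorem inf_posPartLHat_eq_bot_iff (hM : M.IsSimple) {T U : E → SignType} (hT : T ∈ M.topes)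
    (hU : U ∈ M.topes) :
    M.posPartLHat T ⊓ M.posPartLHat U = ⊥ ↔ Disjoint (posPart T) (posPart U) := by
  rw [Finset.disjoint_iff_inter_eq_empty, ← coe_posPartLHat hM hT, ← coe_posPartLHat hM hU]
  exact Subtype.ext_iff

theorem card_antiCommittees_eq_sum_meetDisjointTriples (hM : M.IsSimple)
    (hcyc : ¬ M.IsAcyclic) :
    (M.antiCommittees 3).card = ∑ S ∈ M.meetDisjointTriples, ∏ A ∈ S,
      (M.posInter (M.ex A.1) ∩ -M.posInter (M.ex (M.conv A.1ᶜ))).card := by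
  refine card_eq_sum_prod_card_fiber (posPartLHat_injOn hM) (fun A hA => ?_) (fun A hA => ?_)
    fun S hS A hAS => ?_
  · exact (mem_antiCommittees.1 hA).1.1
  · have hinj : Set.InjOn M.posPartLHat (A : Set (E → SignType)) :=
      (posPartLHat_injOn hM).mono hA
    simp only [mem_antiCommittees, mem_meetDisjointTriples,
      Finset.card_image_of_injOn hinj, Finset.forall_mem_image]
    rw [and_comm]
    refine and_congr_right fun hcard => ?_
    rw [isAntiCommittee_iff_disjoint hM hA hcard]
    constructor
    · refine fun h => ⟨fun T hT => ⟨fun hbot => ?_, fun htop => ?_⟩, fun T hT U hU hne =>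
        (inf_posPartLHat_eq_bot_iff hM (hA hT) (hA hU)).2
          (h T hT U hU fun he => hne (he ▸ rfl))⟩
      · have := congrArg Subtype.val hbot
        rw [coe_posPartLHat hM (hA hT)] at this
        exact (posPart_nonempty hM hcyc (hA hT)).ne_empty this
      · have := congrArg Subtype.val htop
        rw [coe_posPartLHat hM (hA hT)] at this
        exact posPart_ne_univ hM hcyc (hA hT) this
    · exact fun h T hT U hU hne => (inf_posPartLHat_eq_bot_iff hM (hA hT) (hA hU)).1
        (h.2 hT hU fun he => hne (hinj hT hU he))
  · have hne : A.1 ≠ Finset.univ := fun h =>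
      ((mem_meetDisjointTriples.1 hS).2.1 A hAS).2 (Subtype.ext h)
    have hA : M.IsConvex A.1 := A.2.resolve_right hne
    rw [posInter_ex_inter_eq hM hcyc hA.1]
    refine congrArg Finset.card (Finset.filter_congr fun T hT => ?_)
    rw [← coe_posPartLHat hM hT, Subtype.ext_iff]

end Topes

end OrientedMatroid

theorem mainTheorem2 {E : Type*} [Fintype E] [DecidableEq E] (M : OrientedMatroid E)
    (hsimple : M.IsSimple) (hcyclic : ¬ M.IsAcyclic) :
    (∀ A : Finset (E → SignType), A ⊆ M.topes → A.card = 3 →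
      (M.IsAntiCommittee A ↔ ∀ e, (M.posHalfspace e ∩ A).card ≤ 1)) ∧
    (M.committees 3).card = (M.antiCommittees 3).card ∧
    (M.antiCommittees 3).card =
      ∑ S ∈ OrientedMatroid.disjointTriples E, ∏ A ∈ S,
        (M.posInter A \ Aᶜ.biUnion M.posHalfspace).card ∧
    (M.antiCommittees 3).card =
      ∑ S ∈ M.meetDisjointTriples, ∏ A ∈ S,
        (M.posInter (M.ex A.1) ∩ -M.posInter (M.ex (M.conv A.1ᶜ))).card :=
  ⟨fun _ hA hcard => OrientedMatroid.isAntiCommittee_iff_card_le_one hsimple hA hcard,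
    OrientedMatroid.card_committees_eq hsimple 3,
    OrientedMatroid.card_antiCommittees_eq_sum_disjointTriples hsimple hcyclic,
    OrientedMatroid.card_antiCommittees_eq_sum_meetDisjointTriples hsimple hcyclic⟩
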